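/- **Conventions.** A graph has a nonempty set of vertices and a set of oriented edges $e$, each with an initial vertex $e_-$ and a terminal vertex $e_+$, together with an involution $e\mapsto e^{-1}$ exchanging the endpoints (loops and multiple edges are allowed). A path $p$ is a sequence $v_0,e_1,v_1,\dots,e_n,v_n$ with $(e_i)_-=v_{i-1}$, $(e_i)_+=v_i$; its length is $\ell(p)=n$, and $p(k)=v_k$ for $k\le n$, $p(k)=v_n$ for $k\ge n$. The distance $\mathrm d(u,v)$ is the infimum of the lengths of the paths from $u$ to $v$, and a path is geodesic if its length is the distance between its endpoints. Two paths $p,q$ *asynchronously $M$-fellow travel* if there are non-decreasing functions $\phi,\psi\colon\mathbb N\to\mathbb N$ with $\mathrm d(p(t),q(\phi(t)))\le M$ and $\mathrm d(p(\psi(t)),q(t))\le M$ for all $t\in\mathbb N$. For a family $\mathcal P$ of paths let $\mathcal P^+$ be the union of $\mathcal P$ and all one-edge continuations of paths in $\mathcal P$. A graph has the *falsification by fellow traveler property (fftp) relative to $\mathcal P$* if there is $M\ge 0$ such that every $p\in\mathcal P^+$ asynchronously $M$-fellow travels with a path $q\in\mathcal P$ with the same endpoints, and such that moreover $\ell(q)<\ell(p)$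 if $p$ is not geodesic. It has *fftp* if this holds for the family $\mathcal P$ of all paths. For a set $Z$ of vertices and a vertex $v$ let $\pi_Z(v)=\{z\in Z\mid \mathrm d(v,z)=\mathrm d(v,Z)\}$. The set $Z$ has *fellow projections* if there is $M\ge0$ such that for all vertices $u,v$ with $\mathrm d(u,v)=1$ and all $z_v\in\pi_Z(v)$ there is $z_u\in\pi_Z(u)$ with $\mathrm d(z_v,z_u)\le M$. It has *bounded projections* if there is $M\ge0$ such that the diameter of $\pi_Z(u)\cup\pi_Z(v)$ is at most $M$ for all vertices $u,v$ with $\mathrm d(u,v)=1$. For a subgroup $H$ of a group $G$ and a symmetric generating set $X$ of $G$, the *Schreier coset graph* $\Gamma(G,H,X)$ has vertex set $H\backslash G$ and an oriented edge $(Hg,x)$ from $Hg$ to $Hgx$, with inverse $(Hgx,x^{-1})$, for every coset $Hg$ and every $x\in X$. The *Cayley graph* is $\Gamma(G,X)=\Gamma(G,\{1\},X)$. **Theorem B.** Let $G$ be a group and $X$ a finite symmetric generating set of $G$ such that the Cayley graph $\Gamma(G,X)$ has fftp. Let $H\le G$ be a subgroup that, as a set of vertices of $\Gamma(G,X)$,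 has fellow projections. Then: 1. the Schreier coset graph $\Gamma(G,H,X)$ has fftp relative to the family of all paths starting at the vertex $H$; 2. the set of words $\mathrm{Geo}(H\backslash G,X)=\{w\in X^*\mid \ell(w)\le\ell(u)\text{ for all }u\in X^*\text{ representing an element of }Hw\}$ is a regular language over $X$; 3. if moreover $H$ has bounded projections in $\Gamma(G,X)$, and $e_\bullet(n)$ denotes the (finite) number of vertices of $\Gamma(G,H,X)$ at distance at most $n$ from the vertex $H$, then the power series $\sum_{n\ge0}e_\bullet(n)t^n$ is a rational function, that is, there are polynomials $P,Q\in\mathbb Q[t]$ with $Q\neq0$ and $Q\cdot\sum_{n\ge 0} e_\bullet(n)t^n=P$. -/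

import Mathlib

universe u

/-- A graph with oriented edges: a nonempty vertex set, a set of oriented edges with initial and
terminal vertices, and an involution on the edges that exchanges the two endpoints.
Loops and multiple edges are allowed. -/
structure OGraph where
  V : Type u
  E : Type u
  nonempty : Nonempty V
  src : E → V
  tgt : E → V
  inv : E → E
  inv_inv : ∀ e, inv (inv e) = e
  src_inv : ∀ e, src (inv e) = tgt e
  tgt_inv : ∀ e, tgt (inv e) = src e

namespace OGraph

variable (Γ : OGraph.{u})

/-- Consecutive edges of the list match up and the first one starts at the given vertex. -/
def IsWalk : Γ.V → List Γ.E → Prop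
  | _, [] => True
  | v, e :: es => Γ.src e = v ∧ IsWalk (Γ.tgt e) es

/-- The vertex that is reached from `v` along a list of edges. -/
def endOf : Γ.V → List Γ.E → Γ.V
  | v, [] => v
  | _, e :: es => endOf (Γ.tgt e) es

/-- A combinatorial path: an initial vertex followed by a list of consecutive edges. -/
structure Path where
  start : Γ.V
  edges : List Γ.E
  isWalk : Γ.IsWalk start edges

namespace Path

variable {Γ}

/-- The number of edges. -/
def length (p : Γ.Path) : ℕ := p.edges.length

/-- The terminal vertex. -/
def finish (p : Γ.Path) : Γ.V := Γ.endOf p.start p.edges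

/-- The `k`-th vertex of the path; it is the terminal vertex for all `k ≥ p.length`. -/
def vertex (p : Γ.Path) (k : ℕ) : Γ.V := Γ.endOf p.start (p.edges.take k)

end Path

/-- The combinatorial distance (`⊤` if no path joins the two vertices). -/
noncomputable def dist (u v : Γ.V) : ℕ∞ :=
  ⨅ (p : Γ.Path) (_ : p.start = u ∧ p.finish = v), (p.length : ℕ∞)

/-- The vertices of the ball of radius `n` with centre `v`. -/
def ball (v : Γ.V) (n : ℕ) : Set Γ.V := {u | Γ.dist v u ≤ n}

variable {Γ} in
/-- A path is geodesic if it realizes the distance between its endpoints. -/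
def Path.IsGeodesic (p : Γ.Path) : Prop := (p.length : ℕ∞) = Γ.dist p.start p.finish

/-- The paths `p` and `q` asynchronously `M`-fellow travel. -/
def AsyncFellowTravel (M : ℕ) (p q : Γ.Path) : Prop :=
  ∃ φ ψ : ℕ → ℕ, Monotone φ ∧ Monotone ψ ∧
    ∀ t, Γ.dist (p.vertex t) (q.vertex (φ t)) ≤ M ∧ Γ.dist (p.vertex (ψ t)) (q.vertex t) ≤ M

/-- The family `P` together with all the one-edge continuations of its members. -/
def extend (P : Set Γ.Path) : Set Γ.Path :=
  {p' | p' ∈ P ∨ ∃ p ∈ P, ∃ e : Γ.E, p'.start = p.start ∧ p'.edges = p.edges ++ [e]}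

/-- The falsification by `M`-fellow traveler property relative to the family `P`. -/
def IsFFTP (M : ℕ) (P : Set Γ.Path) : Prop :=
  ∀ p ∈ Γ.extend P, ∃ q ∈ P, q.start = p.start ∧ q.finish = p.finish ∧
    Γ.AsyncFellowTravel M p q ∧ (¬ p.IsGeodesic → q.length < p.length)

/-- The falsification by fellow traveler property relative to the family `P`. -/
def HasRelFFTP (P : Set Γ.Path) : Prop := ∃ M : ℕ, Γ.IsFFTP M P

/-- The falsification by fellow traveler property. -/
def HasFFTP : Prop := Γ.HasRelFFTP Set.univ

/-- The closest point projection of the vertex `v` onto the set of vertices `Z`. -/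
def proj (Z : Set Γ.V) (v : Γ.V) : Set Γ.V :=
  {z | z ∈ Z ∧ Γ.dist v z = ⨅ z' ∈ Z, Γ.dist v z'}

/-- The set of vertices `Z` has `M`-fellow projections for some `M`. -/
def HasFellowProjections (Z : Set Γ.V) : Prop :=
  ∃ M : ℕ, ∀ u v, Γ.dist u v = 1 → ∀ zv ∈ Γ.proj Z v, ∃ zu ∈ Γ.proj Z u, Γ.dist zv zu ≤ M

/-- The set of vertices `Z` has `M`-bounded projections for some `M`: the diameter of
`π_Z(u) ∪ π_Z(v)` is at most `M` whenever `u` and `v` are at distance one. -/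
def HasBoundedProjections (Z : Set Γ.V) : Prop :=
  ∃ M : ℕ, ∀ u v, Γ.dist u v = 1 →
    ∀ a ∈ Γ.proj Z u ∪ Γ.proj Z v, ∀ b ∈ Γ.proj Z u ∪ Γ.proj Z v, Γ.dist a b ≤ M

end OGraph

section Groups

variable {G : Type u} [Group G]

/-- The Cayley graph of `G` with respect to the symmetric set `X`: the edge `(g, x)` goes from
`g` to `g * x`, and its inverse is `(g * x, x⁻¹)`. -/
def cayleyGraph (X : Set G) (hX : ∀ x ∈ X, x⁻¹ ∈ X) : OGraph.{u} where
  V := G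
  E := G × X
  nonempty := ⟨1⟩
  src e := e.1
  tgt e := e.1 * e.2
  inv e := (e.1 * e.2, ⟨(e.2 : G)⁻¹, hX _ e.2.2⟩)
  inv_inv e := by ext <;> simp
  src_inv e := rfl
  tgt_inv e := by simp

/-- The set `H \ G` of right cosets `Hg`. -/
abbrev RightCosets (H : Subgroup G) : Type u := Quotient (QuotientGroup.rightRel H)

/-- The right coset `Hg`. -/
def rightCoset (H : Subgroup G) (g : G) : RightCosets H := Quotient.mk _ g

/-- Right multiplication `Hg ↦ Hgx` on right cosets. -/
def RightCosets.mulRight {H : Subgroup G} (c : RightCosets H) (x : G) : RightCosets H :=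
  Quotient.map (fun g => g * x) (fun a b h => by
    have h' : b * a⁻¹ ∈ H := QuotientGroup.rightRel_apply.mp h
    exact QuotientGroup.rightRel_apply.mpr (by simpa [mul_assoc] using h')) c

theorem RightCosets.mulRight_mulRight {H : Subgroup G} (c : RightCosets H) (x y : G) :
    (c.mulRight x).mulRight y = c.mulRight (x * y) := by
  induction c using Quotient.inductionOn with
  | h g => simp [RightCosets.mulRight, mul_assoc]

theorem RightCosets.mulRight_one {H : Subgroup G} (c : RightCosets H) : c.mulRight 1 = c := by
  induction c using Quotient.inductionOn with
  | h g => simp [RightCosets.mulRight]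

/-- The Schreier coset graph of `G` relative to `H` with respect to the symmetric set `X`: the
edge `(Hg, x)` goes from `Hg` to `Hgx`, and its inverse is `(Hgx, x⁻¹)`. -/
def schreierGraph (H : Subgroup G) (X : Set G) (hX : ∀ x ∈ X, x⁻¹ ∈ X) : OGraph.{u} where
  V := RightCosets H
  E := RightCosets H × X
  nonempty := ⟨rightCoset H 1⟩
  src e := e.1
  tgt e := e.1.mulRight e.2
  inv e := (e.1.mulRight e.2, ⟨(e.2 : G)⁻¹, hX _ e.2.2⟩)
  inv_inv e := by
    ext <;> simp [RightCosets.mulRight_mulRight, RightCosets.mulRight_one]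
  src_inv e := rfl
  tgt_inv e := by simp [RightCosets.mulRight_mulRight, RightCosets.mulRight_one]

/-- The element of `G` represented by a word in `X`. -/
def evalWord {X : Set G} (w : List X) : G := (w.map (fun x => (x : G))).prod

/-- The language `Geo(H \ G, X)` of the words `w` that are no longer than any word `u` that
represents an element of the coset `Hw`. -/
def geoLanguage (H : Subgroup G) (X : Set G) : Language X :=
  {w : List X | ∀ u : List X, (∃ h ∈ H, evalWord u = h * evalWord w) → w.length ≤ u.length}

/-- The function `e(n)`: the number of vertices in the ball of radius `n` of the Schreier coset
graph with centre at the coset `H`. -/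
noncomputable def schreierGrowth (H : Subgroup G) (X : Set G) (hX : ∀ x ∈ X, x⁻¹ ∈ X)
    (n : ℕ) : ℕ :=
  ((schreierGraph H X hX).ball (rightCoset H 1) n).ncard

end Groups

/-- A power series is rational if it is a quotient `P / Q` of two polynomials. -/
def PowerSeries.IsRationalSeries (F : PowerSeries ℚ) : Prop :=
  ∃ P Q : Polynomial ℚ, Q ≠ 0 ∧ (Q : PowerSeries ℚ) * F = (P : PowerSeries ℚ)

/-!
The falsification property of the Cayley graph is transferred to paths that start in `H`. Suppose
that `w` represents a shortest path from `H` but `w ++ [x]` does not. Then `1` is a projection of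
the endpoint of `w` to `H`, and fellow projections provide a projection `z` of the endpoint of
`w ++ [x]` at bounded distance from `1`. The path from `z` to `1` followed by the path labelled by
`w ++ [x]` exceeds the distance of its endpoints by a bounded amount, so boundedly many
falsifications turn it into a path from `z` that is shorter than `w ++ [x]`. In this way every word
outside `Geo(H \ G, X)` is falsified, in the Cayley graph and not only in the Schreier coset graph,
by a fellow traveller that starts in `H` (`exists_isFalsifyingConstant`). Its image in the Schreier
coset graph gives the relative falsification property (`hasRelFFTP_schreier`).

For a coset `c` and a word `u` the `defect` of `u` at `c` is
`min 2 (|c| + |u| - |c u|)`, where `|·|` is the distance from `H`. A positive defect is witnessed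
by a path that, after at most two falsifications, passes at bounded Cayley distance from the end of
a geodesic to `c`. Hence the function `defect c` depends only on the differences `|c b| - |c|`
for words `b` of bounded length, and only finitely many functions occur
(`IsFalsifyingConstant.finite_range_defect`).

The defect function is used as the type of a coset. The continuations of a geodesic to `c` inside
`Geo(H \ G, X)` are the words of defect `0` at `c`, so the language has finitely many left quotients
and is regular by the Myhill–Nerode theorem (`isRegular_geoLanguage`). The type of `c` determines
the letters of defect `0`, which lead away from `H`, with the types of the cosets they lead to, and
the number of letters of defect `2`, which lead back towards `H`. Counting the edges between
consecutive spheres twice expresses the numbers of cosets of each type at distance `n + 1` by a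
fixed rational matrix in terms of those at distance `n` (`card_sphere_succ_mul`), and series given
by such a recursion are rational (`isRationalSeries_of_transferMatrix`).
-/

open scoped RightActions

/-! ### Words and action graphs -/

section Words

variable {G : Type u} [Group G] {X : Set G}

@[simp] theorem evalWord_nil : evalWord ([] : List X) = 1 := rfl

@[simp] theorem evalWord_cons (x : X) (w : List X) :
    evalWord (x :: w) = (x : G) * evalWord w := by
  simp [evalWord]

@[simp] theorem evalWord_append (v w : List X) :
    evalWord (v ++ w) = evalWord v * evalWord w := by
  simp [evalWord]

theorem exists_evalWord_inv (hX : ∀ x ∈ X, x⁻¹ ∈ X) (w : List X) :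
    ∃ v : List X, v.length = w.length ∧ evalWord v = (evalWord w)⁻¹ := by
  induction w with
  | nil => exact ⟨[], rfl, by simp⟩
  | cons x w ih =>
    obtain ⟨v, hv, hvw⟩ := ih
    exact ⟨v ++ [⟨(x : G)⁻¹, hX _ x.2⟩], by simp [hv], by simp [hvw]⟩

theorem exists_evalWord_eq (hX : ∀ x ∈ X, x⁻¹ ∈ X) (hgen : Subgroup.closure X = ⊤) (g : G) :
    ∃ w : List X, evalWord w = g := by
  have hg : g ∈ Subgroup.closure X := hgen ▸ Subgroup.mem_top g
  induction hg using Subgroup.closure_induction with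
  | mem x hx => exact ⟨[⟨x, hx⟩], by simp⟩
  | one => exact ⟨[], rfl⟩
  | mul a b _ _ ha hb =>
    obtain ⟨v, rfl⟩ := ha
    obtain ⟨w, rfl⟩ := hb
    exact ⟨v ++ w, by simp⟩
  | inv a _ ha =>
    obtain ⟨w, rfl⟩ := ha
    obtain ⟨v, -, hv⟩ := exists_evalWord_inv hX w
    exact ⟨v, hv⟩

end Words

section ActionGraph

variable {G : Type u} [Group G] {X : Set G} {S : Type u} [MulAction Gᵐᵒᵖ S]

/-- The graph of a right action of `G` on a nonempty set `S` with respect to a symmetric subset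
`X` of `G`: the edge `(s, x)` goes from `s` to `s <• x`. Cayley graphs are the case `S = G` and
Schreier coset graphs the case `S = H \ G`; both identifications hold by definition. -/
abbrev actionGraph (X : Set G) (hX : ∀ x ∈ X, x⁻¹ ∈ X) (S : Type u) [Nonempty S]
    [MulAction Gᵐᵒᵖ S] : OGraph.{u} where
  V := S
  E := S × X
  nonempty := inferInstance
  src e := e.1
  tgt e := e.1 <• (e.2 : G)
  inv e := (e.1 <• (e.2 : G), ⟨(e.2 : G)⁻¹, hX _ e.2.2⟩)
  inv_inv e := by ext <;> simp
  src_inv e := rfl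
  tgt_inv e := by simp

theorem smul_evalWord_append (s : S) (v w : List X) :
    s <• evalWord (v ++ w) = (s <• evalWord v) <• evalWord w := by
  rw [evalWord_append, MulOpposite.op_mul, mul_smul]

/-- The edges of the path that starts at `s` and is labelled by `w`. -/
def wordEdges : S → List X → List (S × X)
  | _, [] => []
  | s, x :: w => (s, x) :: wordEdges (s <• (x : G)) w

theorem length_wordEdges (s : S) (w : List X) : (wordEdges s w).length = w.length := by
  induction w generalizing s with
  | nil => rfl
  | cons x w ih => simp [wordEdges, ih]

theorem take_wordEdges (s : S) (w : List X) (k : ℕ) :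
    (wordEdges s w).take k = wordEdges s (w.take k) := by
  induction w generalizing s k with
  | nil => simp [wordEdges]
  | cons x w ih => cases k <;> simp [wordEdges, ih]

variable [Nonempty S] (hX : ∀ x ∈ X, x⁻¹ ∈ X)

theorem isWalk_wordEdges (s : S) (w : List X) :
    (actionGraph X hX S).IsWalk s (wordEdges s w) := by
  induction w generalizing s with
  | nil => trivial
  | cons x w ih => exact ⟨rfl, ih _⟩

theorem endOf_wordEdges (s : S) (w : List X) :
    (actionGraph X hX S).endOf s (wordEdges s w) = s <• evalWord w := by
  induction w generalizing s with
  | nil => exact (one_smul Gᵐᵒᵖ s).symm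
  | cons x w ih =>
    refine (ih (s <• (x : G))).trans ?_
    rw [evalWord_cons, MulOpposite.op_mul, mul_smul]

/-- The path in the action graph that starts at `s` and is labelled by the word `w`. -/
def wordPath (s : S) (w : List X) : (actionGraph X hX S).Path :=
  ⟨s, wordEdges s w, isWalk_wordEdges hX s w⟩

theorem wordPath_length (s : S) (w : List X) : (wordPath hX s w).length = w.length :=
  length_wordEdges s w

theorem wordPath_finish (s : S) (w : List X) : (wordPath hX s w).finish = s <• evalWord w :=
  endOf_wordEdges hX s w

theorem wordPath_vertex (s : S) (w : List X) (k : ℕ) :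
    (wordPath hX s w).vertex k = s <• evalWord (w.take k) := by
  exact (congrArg ((actionGraph X hX S).endOf s) (take_wordEdges s w k)).trans
    (endOf_wordEdges hX s (w.take k))

theorem eq_wordEdges_of_isWalk (s : S) (es : List (S × X))
    (h : (actionGraph X hX S).IsWalk s es) : es = wordEdges s (es.map Prod.snd) := by
  induction es generalizing s with
  | nil => rfl
  | cons e es ih =>
    obtain ⟨t, x⟩ := e
    obtain ⟨h₁, h₂⟩ := h
    change t = s at h₁
    subst h₁
    have := ih _ h₂
    exact congrArg (List.cons (t, x)) this

theorem exists_eq_wordPath (p : (actionGraph X hX S).Path) :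
    ∃ w : List X, p = wordPath hX (S := S) p.start w := by
  obtain ⟨s, es, h⟩ := p
  refine ⟨List.map (Prod.snd : S × X → X) es, ?_⟩
  have := eq_wordEdges_of_isWalk hX s es h
  unfold wordPath
  congr

theorem actionGraph_dist_le_iff (s t : S) (n : ℕ) :
    (actionGraph X hX S).dist s t ≤ n ↔
      ∃ w : List X, w.length ≤ n ∧ s <• evalWord w = t := by
  constructor
  · intro h
    have h' : (actionGraph X hX S).dist s t < ((n + 1 : ℕ) : ℕ∞) :=
      lt_of_le_of_lt h (by exact_mod_cast Nat.lt_succ_self n)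
    simp only [OGraph.dist, iInf_lt_iff] at h'
    obtain ⟨p, ⟨h₁, h₂⟩, h₃⟩ := h'
    obtain ⟨w, hw⟩ := exists_eq_wordPath hX p
    rw [h₁] at hw
    subst hw
    rw [wordPath_finish] at h₂
    rw [wordPath_length] at h₃
    exact ⟨w, Nat.lt_succ_iff.mp (by exact_mod_cast h₃), h₂⟩
  · rintro ⟨w, hw, rfl⟩
    refine (iInf₂_le (wordPath hX s w) ⟨rfl, wordPath_finish hX s w⟩).trans ?_
    rw [wordPath_length]
    exact_mod_cast hw

theorem actionGraph_dist_self_le (s : S) (n : ℕ) : (actionGraph X hX S).dist s s ≤ n :=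
  (actionGraph_dist_le_iff hX s s n).2 ⟨[], by simp, by simp⟩

theorem actionGraph_dist_le_symm {s t : S} {n : ℕ} (h : (actionGraph X hX S).dist s t ≤ n) :
    (actionGraph X hX S).dist t s ≤ n := by
  rw [actionGraph_dist_le_iff] at h ⊢
  obtain ⟨w, hw, rfl⟩ := h
  obtain ⟨v, hv, hvw⟩ := exists_evalWord_inv hX w
  exact ⟨v, hv ▸ hw, by simp [hvw]⟩

theorem actionGraph_dist_le_trans {r s t : S} {m n : ℕ}
    (h₁ : (actionGraph X hX S).dist r s ≤ m) (h₂ : (actionGraph X hX S).dist s t ≤ n) :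
    (actionGraph X hX S).dist r t ≤ (m + n : ℕ) := by
  rw [actionGraph_dist_le_iff] at h₁ h₂ ⊢
  obtain ⟨v, hv, rfl⟩ := h₁
  obtain ⟨w, hw, rfl⟩ := h₂
  exact ⟨v ++ w, by simp; omega, smul_evalWord_append r v w⟩

theorem exists_shorter_of_not_isGeodesic {s : S} {w : List X}
    (h : ¬ (wordPath hX s w).IsGeodesic) :
    ∃ v : List X, v.length < w.length ∧ s <• evalWord v = s <• evalWord w := by
  have hle : (actionGraph X hX S).dist s (s <• evalWord w) ≤ w.length :=
    (actionGraph_dist_le_iff hX _ _ _).2 ⟨w, le_rfl, rfl⟩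
  have hne : (w.length : ℕ∞) ≠ (actionGraph X hX S).dist s (s <• evalWord w) := by
    intro he
    apply h
    unfold OGraph.Path.IsGeodesic
    rw [wordPath_length, wordPath_finish]
    exact he
  have hlt := lt_of_le_of_ne hle hne.symm
  obtain ⟨n, hn⟩ := ENat.ne_top_iff_exists.mp hlt.ne_top
  rw [← hn] at hlt
  obtain ⟨v, hv, hvw⟩ := (actionGraph_dist_le_iff hX _ _ n).1 hn.ge
  exact ⟨v, lt_of_le_of_lt hv (by exact_mod_cast hlt), hvw⟩

theorem not_isGeodesic_of_shorter {s : S} {v w : List X} (hvw : v.length < w.length)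
    (he : s <• evalWord v = s <• evalWord w) : ¬ (wordPath hX s w).IsGeodesic := by
  unfold OGraph.Path.IsGeodesic
  rw [wordPath_length, wordPath_finish]
  have hle : (actionGraph X hX S).dist s (s <• evalWord w) ≤ v.length :=
    (actionGraph_dist_le_iff hX _ _ _).2 ⟨v, le_rfl, he⟩
  exact (lt_of_le_of_lt hle (by exact_mod_cast hvw)).ne'

/-! ### Fellow travelling of labelled paths -/

theorem asyncFellowTravel_refl (M : ℕ) (p : (actionGraph X hX S).Path) :
    (actionGraph X hX S).AsyncFellowTravel M p p :=
  ⟨id, id, monotone_id, monotone_id, fun _ =>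
    ⟨actionGraph_dist_self_le hX _ _, actionGraph_dist_self_le hX _ _⟩⟩

theorem OGraph.AsyncFellowTravel.trans_actionGraph {M N : ℕ} {p q r : (actionGraph X hX S).Path}
    (h₁ : (actionGraph X hX S).AsyncFellowTravel M p q)
    (h₂ : (actionGraph X hX S).AsyncFellowTravel N q r) :
    (actionGraph X hX S).AsyncFellowTravel (M + N) p r := by
  obtain ⟨φ, ψ, hφ, hψ, h⟩ := h₁
  obtain ⟨φ', ψ', hφ', hψ', h'⟩ := h₂
  exact ⟨φ' ∘ φ, ψ ∘ ψ', hφ'.comp hφ, hψ.comp hψ', fun t =>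
    ⟨actionGraph_dist_le_trans hX (h t).1 (h' (φ t)).1,
      actionGraph_dist_le_trans hX (h (ψ' t)).2 (h' t).2⟩⟩

theorem OGraph.AsyncFellowTravel.mono {Γ : OGraph.{u}} {M N : ℕ} (hMN : M ≤ N) {p q : Γ.Path}
    (h : Γ.AsyncFellowTravel M p q) : Γ.AsyncFellowTravel N p q := by
  obtain ⟨φ, ψ, hφ, hψ, h⟩ := h
  have hMN' : (M : ℕ∞) ≤ N := by exact_mod_cast hMN
  exact ⟨φ, ψ, hφ, hψ, fun t => ⟨(h t).1.trans hMN', (h t).2.trans hMN'⟩⟩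

/-- Continuing two fellow travelling paths with a common terminal vertex by the same edge does
not change the constant. -/
theorem asyncFellowTravel_append {M : ℕ} {s s' : S} {w w' : List X}
    (hend : s <• evalWord w = s' <• evalWord w')
    (h : (actionGraph X hX S).AsyncFellowTravel M (wordPath hX s w) (wordPath hX s' w')) (x : X) :
    (actionGraph X hX S).AsyncFellowTravel M (wordPath hX s (w ++ [x]))
      (wordPath hX s' (w' ++ [x])) := by
  obtain ⟨φ, ψ, hφ, hψ, h⟩ := h
  simp only [wordPath_vertex] at h
  -- Beyond the terminal vertex of `w` the parameter is sent to the terminal vertex of `w' ++ [x]`.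
  have key : ∀ (n n' : ℕ) (f : ℕ → ℕ), Monotone f →
      Monotone fun t => if t ≤ n then min (f t) n' else n' + 1 := by
    intro n n' f hf a b hab
    have := hf hab
    dsimp only
    split_ifs <;> omega
  have hend' : s <• evalWord (w ++ [x]) = s' <• evalWord (w' ++ [x]) := by
    rw [smul_evalWord_append, smul_evalWord_append, hend]
  have htake : ∀ (v : List X) (t : ℕ), t ≤ v.length → (v ++ [x]).take t = v.take t :=
    fun v t ht => List.take_append_of_le_length ht
  have hmin : ∀ (v : List X) (t : ℕ), (v ++ [x]).take (min t v.length) = v.take t := by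
    intro v t
    rw [htake v _ (min_le_right _ _), List.take_eq_take_iff]
    omega
  have hfull : ∀ (v : List X) (t : ℕ), v.length < t → (v ++ [x]).take t = v ++ [x] :=
    fun v t ht => List.take_of_length_le (by simp; omega)
  refine ⟨_, _, key w.length w'.length φ hφ, key w'.length w.length ψ hψ, fun t => ?_⟩
  simp only [wordPath_vertex]
  constructor
  · split_ifs with ht
    · rw [htake w t ht, hmin]
      exact (h t).1
    · rw [hfull w t (by omega), hfull w' _ (by omega), hend']
      exact actionGraph_dist_self_le hX _ _
  · split_ifs with ht
    · rw [htake w' t ht, hmin]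
      exact (h t).2
    · rw [hfull w' t (by omega), hfull w _ (by omega), hend']
      exact actionGraph_dist_self_le hX _ _

/-- Prefixing a path by a path of length at most `M` gives an `M`-fellow traveller. -/
theorem asyncFellowTravel_prefix {M : ℕ} {s s' : S} {a : List X} (ha : a.length ≤ M)
    (hs : s' <• evalWord a = s) (w : List X) :
    (actionGraph X hX S).AsyncFellowTravel M (wordPath hX s w) (wordPath hX s' (a ++ w)) := by
  have hlate : ∀ t, s' <• evalWord ((a ++ w).take (a.length + t)) = s <• evalWord (w.take t) := by
    intro t
    rw [List.take_length_add_append, smul_evalWord_append, hs]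
  refine ⟨fun t => a.length + t, fun t => t - a.length, fun _ _ h => by simpa using h,
    fun _ _ h => Nat.sub_le_sub_right h _, fun t => ?_⟩
  simp only [wordPath_vertex]
  constructor
  · rw [hlate]
    exact actionGraph_dist_self_le hX _ _
  · rcases le_total a.length t with ht | ht
    · obtain ⟨k, rfl⟩ := Nat.exists_eq_add_of_le ht
      rw [hlate, Nat.add_sub_cancel_left]
      exact actionGraph_dist_self_le hX _ _
    · rw [Nat.sub_eq_zero_of_le ht, List.take_zero, List.take_append_of_le_length ht]
      refine actionGraph_dist_le_symm hX ((actionGraph_dist_le_iff hX _ _ _).2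
        ⟨a.drop t, by simp; omega, ?_⟩)
      rw [← smul_evalWord_append, List.take_append_drop, hs]
      simp

end ActionGraph

/-- The right action of `G` on the right cosets of `H`. -/
instance RightCosets.instMulAction {G : Type u} [Group G] (H : Subgroup G) :
    MulAction Gᵐᵒᵖ (RightCosets H) where
  smul g c := c.mulRight g.unop
  one_smul := RightCosets.mulRight_one
  mul_smul g h c := (RightCosets.mulRight_mulRight c h.unop g.unop).symm

instance RightCosets.instNonempty {G : Type u} [Group G] (H : Subgroup G) :
    Nonempty (RightCosets H) := ⟨rightCoset H 1⟩

/-! ### Falsification of words in the Cayley graph -/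

section Falsification

variable {G : Type u} [Group G] {X : Set G} {H : Subgroup G} (hX : ∀ x ∈ X, x⁻¹ ∈ X)

theorem cayley_dist_le_iff (g h : G) (n : ℕ) :
    (actionGraph X hX G).dist g h ≤ n ↔ ∃ w : List X, w.length ≤ n ∧ g * evalWord w = h :=
  actionGraph_dist_le_iff hX g h n

/-- `n` applications of the falsification property shorten a word by `n` at the cost of a
fellow traveller constant `n * M`. -/
theorem exists_fellowTraveller_of_isFFTP {M : ℕ}
    (hM : (actionGraph X hX G).IsFFTP M Set.univ) (g : G) {m : ℕ} (n : ℕ) (w w₀ : List X)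
    (hw : w.length ≤ m + n) (hw₀ : w₀.length ≤ m) (he : evalWord w₀ = evalWord w) :
    ∃ q : List X, q.length ≤ m ∧ evalWord q = evalWord w ∧
      (actionGraph X hX G).AsyncFellowTravel (n * M) (wordPath hX g w) (wordPath hX g q) := by
  induction n generalizing w with
  | zero => exact ⟨w, hw, rfl, asyncFellowTravel_refl hX _ _⟩
  | succ n ih =>
    rcases le_or_gt w.length (m + n) with hle | hgt
    · obtain ⟨q, hq, hqe, hqf⟩ := ih w hle he
      exact ⟨q, hq, hqe, hqf.mono (Nat.mul_le_mul_right M n.le_succ)⟩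
    · obtain ⟨p, -, hs, hf, hp, hlt⟩ := hM (wordPath hX g w) (Or.inl trivial)
      obtain ⟨v, hv⟩ := exists_eq_wordPath hX p
      have hs' : p.start = g := hs
      rw [hs'] at hv
      subst hv
      rw [wordPath_finish, wordPath_finish] at hf
      have hve : evalWord v = evalWord w := mul_left_cancel hf
      have hlt' := hlt (not_isGeodesic_of_shorter hX (v := w₀) (by omega)
        (congrArg (g * ·) he))
      rw [wordPath_length, wordPath_length] at hlt'
      obtain ⟨q, hq, hqe, hqf⟩ := ih v (by omega) (he.trans hve.symm)
      refine ⟨q, hq, hqe.trans hve, ?_⟩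
      rw [Nat.succ_mul, Nat.add_comm]
      exact hp.trans_actionGraph hX hqf

theorem length_le_of_mem_geoLanguage {w u : List X} (hw : w ∈ geoLanguage H X) {z : G}
    (hz : z ∈ H) (h : z * evalWord u = evalWord w) : w.length ≤ u.length :=
  hw u ⟨z⁻¹, H.inv_mem hz, by rw [← h]; group⟩

/-- The constant `K` is such that each word outside `Geo(H \ G, X)` is falsified in the Cayley
graph: the path from `1` labelled by the word is `K`-fellow travelled by a shorter path with the
same terminal vertex whose initial vertex lies in `H`. -/
def IsFalsifyingConstant (H : Subgroup G) (K : ℕ) : Prop :=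
  ∀ w : List X, w ∉ geoLanguage H X → ∃ z ∈ H, ∃ q : List X, z * evalWord q = evalWord w ∧
    q.length < w.length ∧
    (actionGraph X hX G).AsyncFellowTravel K (wordPath hX (1 : G) w) (wordPath hX z q)

/-- A path labelled by a word in `Geo(H \ G, X)` that starts at `1` ends at a vertex that has `1`
among its projections to `H`. -/
theorem one_mem_proj {w : List X} (hw : w ∈ geoLanguage H X) :
    (1 : G) ∈ (actionGraph X hX G).proj (H : Set G) (evalWord w : G) := by
  refine ⟨H.one_mem, le_antisymm (le_iInf₂ fun z hz => ?_) (iInf₂_le (1 : G) H.one_mem)⟩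
  have h₁ : (actionGraph X hX G).dist (evalWord w : G) (1 : G) ≤ w.length :=
    actionGraph_dist_le_symm hX ((cayley_dist_le_iff hX _ _ _).2 ⟨w, le_rfl, one_mul _⟩)
  refine h₁.trans ?_
  by_contra! hlt
  obtain ⟨n, hn⟩ := ENat.ne_top_iff_exists.mp hlt.ne_top
  rw [← hn] at hlt
  obtain ⟨u, hu, hue⟩ := (cayley_dist_le_iff hX _ _ n).1
    (actionGraph_dist_le_symm hX hn.ge)
  have := length_le_of_mem_geoLanguage hw hz hue
  have : n < w.length := by exact_mod_cast hlt
  omega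

/-- If `w` is in `Geo(H \ G, X)` but `w ++ [x]` is not, then the projection of the endpoint of
`w ++ [x]` to `H` that lies close to `1` is the initial vertex of a shorter path. Prefixing
`w ++ [x]` by a short path from that vertex makes the falsification property applicable. -/
theorem exists_isFalsifyingConstant (hfftp : (actionGraph X hX G).HasFFTP)
    (hH : (actionGraph X hX G).HasFellowProjections (H : Set G)) :
    ∃ K, IsFalsifyingConstant hX H K := by
  obtain ⟨M, hM⟩ := hfftp
  obtain ⟨N, hN⟩ := hH
  refine ⟨N + (N + 1) * M, fun w => ?_⟩
  induction w using List.reverseRecOn with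
  | nil => exact fun h => absurd (show ([] : List X) ∈ geoLanguage H X from
      fun u _ => Nat.zero_le u.length) h
  | append_singleton w x ih =>
    intro hwx
    by_cases hw : w ∈ geoLanguage H X
    · have hadj : (actionGraph X hX G).dist (evalWord w : G) (evalWord (w ++ [x]) : G) ≤ (1 : ℕ) :=
        (cayley_dist_le_iff hX _ _ _).2 ⟨[x], by simp, by simp⟩
      have hadj' := actionGraph_dist_le_symm hX hadj
      obtain ⟨z, hz, hz1⟩ : ∃ z ∈ (actionGraph X hX G).proj (H : Set G) (evalWord (w ++ [x]) : G),
          (actionGraph X hX G).dist (1 : G) z ≤ N := by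
        rcases hadj'.lt_or_eq with hlt | heq
        -- At distance zero the letter `x` represents `1`, and the projection is `1` itself.
        · have h0 : (actionGraph X hX G).dist (evalWord (w ++ [x]) : G) (evalWord w : G) ≤
              (0 : ℕ) := by
            have : (actionGraph X hX G).dist (evalWord (w ++ [x]) : G) (evalWord w : G) < 1 := hlt
            rw [Order.lt_one_iff] at this
            rw [this]; simp
          obtain ⟨v, hv, hve⟩ := (cayley_dist_le_iff hX _ _ _).1 h0
          obtain rfl : v = [] := List.length_eq_zero_iff.mp (Nat.le_zero.mp hv)
          refine ⟨(1 : G), ?_, actionGraph_dist_self_le hX _ _⟩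
          have hee : evalWord (w ++ [x]) = evalWord w := by simpa using hve
          rw [hee]
          exact one_mem_proj hX hw
        · exact hN _ _ (by exact_mod_cast heq) _ (one_mem_proj hX hw)
      obtain ⟨a, ha, hae⟩ := (cayley_dist_le_iff hX z 1 N).1 (actionGraph_dist_le_symm hX hz1)
      -- A word witnessing that `w ++ [x]` is not in the language bounds the distance to `z`.
      obtain ⟨w₀, hw₀, hw₀e⟩ : ∃ w₀ : List X, w₀.length ≤ w.length ∧
          z * evalWord w₀ = evalWord (w ++ [x]) := by
        have : ∃ u : List X, (∃ h ∈ H, evalWord u = h * evalWord (w ++ [x])) ∧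
            u.length < (w ++ [x]).length := by
          by_contra! hcon
          exact hwx hcon
        obtain ⟨u, ⟨h, hh, hu⟩, hlen⟩ := this
        have hle : (actionGraph X hX G).dist (evalWord (w ++ [x]) : G) z ≤ w.length := by
          rw [hz.2]
          refine (iInf₂_le h⁻¹ (H.inv_mem hh)).trans
            (actionGraph_dist_le_symm hX ((cayley_dist_le_iff hX _ _ _).2
              ⟨u, by simp at hlen; omega, by rw [hu]; group⟩))
        exact (cayley_dist_le_iff hX _ _ _).1 (actionGraph_dist_le_symm hX hle)
      have hae' : evalWord w₀ = evalWord (a ++ (w ++ [x])) := by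
        rw [evalWord_append, ← hw₀e, ← mul_assoc, eq_comm]
        have : evalWord a = z⁻¹ := eq_inv_of_mul_eq_one_right hae
        rw [this]; group
      obtain ⟨q, hq, hqe, hqf⟩ := exists_fellowTraveller_of_isFFTP hX hM z (N + 1)
        (a ++ (w ++ [x])) w₀ (m := w.length) (by simp; omega) hw₀ hae'
      refine ⟨z, hz.1, q, by rw [hqe, ← hae', hw₀e], by simp; omega, ?_⟩
      exact (asyncFellowTravel_prefix hX ha hae _).trans_actionGraph hX hqf
    · obtain ⟨z, hz, q, hqe, hq, hqf⟩ := ih hw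
      refine ⟨z, hz, q ++ [x], ?_, by simpa using hq, ?_⟩
      · rw [evalWord_append, evalWord_append, ← mul_assoc, hqe]
      · exact asyncFellowTravel_append hX (show 1 * evalWord w = z * evalWord q by
          rw [one_mul, hqe]) hqf x

/-! ### Relative falsification in the Schreier coset graph -/

theorem rightCoset_smul (H : Subgroup G) (g h : G) :
    rightCoset H g <• h = rightCoset H (g * h) := rfl

theorem rightCoset_eq_iff_exists {g h : G} :
    rightCoset H g = rightCoset H h ↔ ∃ z ∈ H, z * g = h := by
  refine Quotient.eq.trans (QuotientGroup.rightRel_apply.trans ⟨fun hz => ?_, ?_⟩)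
  · exact ⟨h * g⁻¹, hz, by group⟩
  · rintro ⟨z, hz, rfl⟩
    simpa using hz

theorem schreier_dist_le {g h : G} {n : ℕ} (hn : (actionGraph X hX G).dist g h ≤ n) :
    (actionGraph X hX (RightCosets H)).dist (rightCoset H g) (rightCoset H h) ≤ n := by
  obtain ⟨w, hw, rfl⟩ := (cayley_dist_le_iff hX _ _ _).1 hn
  exact (actionGraph_dist_le_iff hX _ _ _).2 ⟨w, hw, rfl⟩

theorem hasRelFFTP_schreier {K : ℕ} (hK : IsFalsifyingConstant hX H K) :
    (actionGraph X hX (RightCosets H)).HasRelFFTP {p | p.start = rightCoset H 1} := by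
  refine ⟨K, fun p hp => ?_⟩
  have hstart : p.start = rightCoset H 1 := by
    rcases hp with hp | ⟨p', hp', e, hpe, -⟩
    · exact hp
    · exact hpe.trans hp'
  obtain ⟨w, hw⟩ := exists_eq_wordPath hX p
  rw [hstart] at hw
  subst hw
  by_cases hgeo : (wordPath hX (rightCoset H 1) w).IsGeodesic
  · exact ⟨_, hstart, rfl, rfl, asyncFellowTravel_refl hX _ _, fun h => absurd hgeo h⟩
  obtain ⟨v, hv, hve⟩ := exists_shorter_of_not_isGeodesic hX hgeo
  have hwgeo : w ∉ geoLanguage H X := by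
    intro hmem
    rw [rightCoset_smul, rightCoset_smul, one_mul, one_mul, rightCoset_eq_iff_exists] at hve
    obtain ⟨z, hz, hze⟩ := hve
    have := length_le_of_mem_geoLanguage hmem hz hze
    omega
  obtain ⟨z, hz, q, hqe, hq, φ, ψ, hφ, hψ, hf⟩ := hK w hwgeo
  have hproj : ∀ u : List X, rightCoset H (z * evalWord u) = rightCoset H 1 <• evalWord u :=
    fun u => (rightCoset_eq_iff_exists.2 ⟨z, hz, congrArg (z * ·) (one_mul _)⟩).symm
  refine ⟨wordPath hX (rightCoset H 1) q, rfl, rfl, ?_, ⟨φ, ψ, hφ, hψ, fun t => ?_⟩, fun _ => ?_⟩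
  · rw [wordPath_finish, wordPath_finish, ← hproj, hqe, rightCoset_smul, one_mul]
  · have ht := hf t
    simp only [wordPath_vertex] at ht ⊢
    have h₁ := schreier_dist_le (H := H) hX ht.1
    have h₂ := schreier_dist_le (H := H) hX ht.2
    rw [show rightCoset H (z <• evalWord _) = _ from hproj _] at h₁ h₂
    exact ⟨h₁, h₂⟩
  · rwa [wordPath_length, wordPath_length]

end Falsification

/-! ### Lengths of cosets and the defect function -/

section Defect

variable {G : Type u} [Group G] {X : Set G} {H : Subgroup G}

/-- The length of the shortest words representing an element of the coset `c`; this is the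
distance of `c` from `H` in the Schreier coset graph. -/
noncomputable def cosetLength (X : Set G) (c : RightCosets H) : ℕ :=
  sInf {n | ∃ w : List X, w.length = n ∧ rightCoset H (evalWord w) = c}

theorem cosetLength_le (w : List X) :
    cosetLength X (rightCoset H (evalWord w)) ≤ w.length :=
  Nat.sInf_le ⟨w, rfl, rfl⟩

theorem exists_length_eq_cosetLength (hX : ∀ x ∈ X, x⁻¹ ∈ X) (hgen : Subgroup.closure X = ⊤)
    (c : RightCosets H) :
    ∃ w : List X, w.length = cosetLength X c ∧ rightCoset H (evalWord w) = c := by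
  refine Nat.sInf_mem (s := {n | ∃ w : List X, w.length = n ∧ rightCoset H (evalWord w) = c}) ?_
  obtain ⟨g, rfl⟩ := Quotient.exists_rep c
  obtain ⟨w, rfl⟩ := exists_evalWord_eq hX hgen g
  exact ⟨_, w, rfl, rfl⟩

theorem cosetLength_smul_le (hX : ∀ x ∈ X, x⁻¹ ∈ X) (hgen : Subgroup.closure X = ⊤)
    (c : RightCosets H) (u : List X) :
    cosetLength X (c <• evalWord u) ≤ cosetLength X c + u.length := by
  obtain ⟨w, hw, rfl⟩ := exists_length_eq_cosetLength hX hgen c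
  rw [rightCoset_smul, ← evalWord_append, ← hw, ← List.length_append]
  exact cosetLength_le _

theorem cosetLength_le_smul (hX : ∀ x ∈ X, x⁻¹ ∈ X) (hgen : Subgroup.closure X = ⊤)
    (c : RightCosets H) (u : List X) :
    cosetLength X c ≤ cosetLength X (c <• evalWord u) + u.length := by
  obtain ⟨v, hv, hvu⟩ := exists_evalWord_inv hX u
  have := cosetLength_smul_le hX hgen (c <• evalWord u) v
  rwa [hvu, ← mul_smul, ← MulOpposite.op_mul, mul_inv_cancel, MulOpposite.op_one, one_smul,
    hv] at this

theorem mem_geoLanguage_iff (hX : ∀ x ∈ X, x⁻¹ ∈ X) (hgen : Subgroup.closure X = ⊤)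
    (w : List X) :
    w ∈ geoLanguage H X ↔ w.length = cosetLength X (rightCoset H (evalWord w)) := by
  constructor
  · intro hw
    obtain ⟨v, hv, hvw⟩ := exists_length_eq_cosetLength hX hgen (rightCoset H (evalWord w))
    obtain ⟨z, hz, hze⟩ := rightCoset_eq_iff_exists.1 hvw
    exact le_antisymm (hv ▸ length_le_of_mem_geoLanguage hw hz hze) (cosetLength_le w)
  · rintro hw u ⟨h, hh, hu⟩
    rw [hw, rightCoset_eq_iff_exists.2 ⟨h, hh, hu.symm⟩]
    exact cosetLength_le u

/-- The failure, truncated at `2`, of the path labelled by `u` to lead straight away from `H` when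
it starts at the coset `c`. The value `0` means that geodesics from `H` to `c` can be continued
by `u`. A single letter has the value `2` exactly if it leads one step closer to `H`, which is why
the truncation at `2` retains enough information for counting. -/
noncomputable def defect (c : RightCosets H) (u : List X) : ℕ :=
  min 2 (cosetLength X c + u.length - cosetLength X (c <• evalWord u))

theorem le_defect_iff (hX : ∀ x ∈ X, x⁻¹ ∈ X) (hgen : Subgroup.closure X = ⊤)
    {c : RightCosets H} {u : List X} {j : ℕ} :
    j ≤ defect c u ↔
      j ≤ 2 ∧ cosetLength X (c <• evalWord u) + j ≤ cosetLength X c + u.length := by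
  have := cosetLength_smul_le hX hgen c u
  unfold defect
  omega

theorem defect_eq_zero_iff (hX : ∀ x ∈ X, x⁻¹ ∈ X) (hgen : Subgroup.closure X = ⊤)
    {c : RightCosets H} {u : List X} :
    defect c u = 0 ↔ cosetLength X (c <• evalWord u) = cosetLength X c + u.length := by
  have := cosetLength_smul_le hX hgen c u
  unfold defect
  omega

theorem defect_singleton_eq_two_iff (hX : ∀ x ∈ X, x⁻¹ ∈ X) (hgen : Subgroup.closure X = ⊤)
    {c : RightCosets H} {x : X} :
    defect c [x] = 2 ↔ cosetLength X (c <• (x : G)) + 1 = cosetLength X c := by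
  have := cosetLength_le_smul hX hgen c [x]
  simp only [evalWord_cons, evalWord_nil, mul_one, List.length_singleton] at this
  simp only [defect, evalWord_cons, evalWord_nil, mul_one, List.length_singleton]
  omega

/-- The defects at a neighbour of `c` farther away from `H` are determined by those at `c`. -/
theorem defect_smul (hX : ∀ x ∈ X, x⁻¹ ∈ X) (hgen : Subgroup.closure X = ⊤)
    {c : RightCosets H} {v : List X} (hv : defect c v = 0) (u : List X) :
    defect (c <• evalWord v) u = defect c (v ++ u) := by
  rw [defect_eq_zero_iff hX hgen] at hv
  unfold defect
  rw [smul_evalWord_append, hv, List.length_append, Nat.add_assoc]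

/-- `j` successive falsifications of a path that is `j` longer than permitted. -/
theorem IsFalsifyingConstant.exists_path {hX : ∀ x ∈ X, x⁻¹ ∈ X}
    (hgen : Subgroup.closure X = ⊤) {K : ℕ} (hK : IsFalsifyingConstant hX H K) {m : ℕ} (j : ℕ)
    (w : List X) (hw : w.length ≤ m + j) (hm : cosetLength X (rightCoset H (evalWord w)) ≤ m) :
    ∃ z ∈ H, ∃ q : List X, q.length ≤ m ∧ z * evalWord q = evalWord w ∧
      ∀ t, ∃ s, (actionGraph X hX G).dist (evalWord (w.take t) : G)
        (z * evalWord (q.take s) : G) ≤ (j * K : ℕ) := by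
  induction j generalizing w with
  | zero =>
    exact ⟨1, H.one_mem, w, hw, one_mul _, fun t => ⟨t, by
      rw [one_mul]; exact actionGraph_dist_self_le hX _ _⟩⟩
  | succ j ih =>
    rcases le_or_gt w.length (m + j) with hle | hgt
    · obtain ⟨z, hz, q, hq, hqe, hd⟩ := ih w hle hm
      refine ⟨z, hz, q, hq, hqe, fun t => ?_⟩
      obtain ⟨s, hs⟩ := hd t
      exact ⟨s, hs.trans (by exact_mod_cast Nat.mul_le_mul_right K j.le_succ)⟩
    · have hgeo : w ∉ geoLanguage H X := by
        rw [mem_geoLanguage_iff hX hgen]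
        omega
      obtain ⟨y, hy, p, hpe, hp, φ, ψ, -, -, hf⟩ := hK w hgeo
      have hcos : rightCoset H (evalWord p) = rightCoset H (evalWord w) :=
        rightCoset_eq_iff_exists.2 ⟨y, hy, hpe⟩
      obtain ⟨z, hz, q, hq, hqe, hd⟩ := ih p (by omega) (hcos ▸ hm)
      refine ⟨y * z, H.mul_mem hy hz, q, hq, by rw [mul_assoc, hqe, hpe], fun t => ?_⟩
      obtain ⟨s, hs⟩ := hd (φ t)
      refine ⟨s, ?_⟩
      have ht := (hf t).1
      simp only [wordPath_vertex] at ht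
      have ht' : (actionGraph X hX G).dist (evalWord (w.take t) : G)
          (y * evalWord (p.take (φ t)) : G) ≤ K := by
        rw [← one_mul (evalWord (w.take t))]
        exact ht
      -- The second falsification is moved by `y`, which is an automorphism of the Cayley graph.
      have hs' : (actionGraph X hX G).dist (y * evalWord (p.take (φ t)) : G)
          (y * z * evalWord (q.take s) : G) ≤ (j * K : ℕ) := by
        obtain ⟨a, ha, hae⟩ := (cayley_dist_le_iff hX _ _ _).1 hs
        exact (cayley_dist_le_iff hX _ _ _).2 ⟨a, ha, by rw [mul_assoc, hae, mul_assoc]⟩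
      rw [Nat.succ_mul, Nat.add_comm]
      exact actionGraph_dist_le_trans hX ht' hs'

/-- A path witnessing a positive defect passes close to `c`, so that defects can be computed from
the lengths of the cosets close to `c`. -/
theorem IsFalsifyingConstant.le_defect_iff_exists {hX : ∀ x ∈ X, x⁻¹ ∈ X}
    (hgen : Subgroup.closure X = ⊤) {K : ℕ} (hK : IsFalsifyingConstant hX H K)
    (c : RightCosets H) (u : List X) {j : ℕ} (hj : j ≤ 2) :
    j ≤ defect c u ↔ ∃ b : List X, b.length ≤ 2 * K ∧ ∃ v : List X,
      evalWord (b ++ v) = evalWord u ∧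
      cosetLength X (c <• evalWord b) + v.length + j ≤ cosetLength X c + u.length := by
  rw [le_defect_iff hX hgen]
  constructor
  · rintro ⟨-, hle⟩
    obtain ⟨w, hw, rfl⟩ := exists_length_eq_cosetLength hX hgen c
    rw [rightCoset_smul, ← evalWord_append] at hle
    obtain ⟨z, hz, q, hq, hqe, hd⟩ := hK.exists_path hgen
      (m := w.length + u.length - j) j (w ++ u) (by simp; omega) (by omega)
    obtain ⟨s, hs⟩ := hd w.length
    rw [List.take_left] at hs
    obtain ⟨b, hb, hbe⟩ := (cayley_dist_le_iff hX _ _ _).1 hs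
    refine ⟨b, hb.trans (Nat.mul_le_mul_right K hj), q.drop s, ?_, ?_⟩
    · apply mul_left_cancel (a := evalWord w)
      rw [evalWord_append, ← mul_assoc, hbe, mul_assoc, ← evalWord_append,
        List.take_append_drop, hqe, evalWord_append]
    · have hle' : cosetLength X (rightCoset H (evalWord w) <• evalWord b) ≤
          (q.take s).length := by
        rw [rightCoset_smul, hbe, ← rightCoset_eq_iff_exists.2 ⟨z, hz, rfl⟩]
        exact cosetLength_le _
      have := congrArg List.length (List.take_append_drop s q)
      rw [List.length_append] at this
      omega
  · rintro ⟨b, -, v, hbv, hle⟩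
    have := cosetLength_smul_le hX hgen (c <• evalWord b) v
    rw [← smul_evalWord_append, hbv] at this
    exact ⟨hj, by omega⟩

/-- There are only finitely many defect functions, because the lengths of the cosets at bounded
distance from `c` differ from the length of `c` by a bounded amount. -/
theorem IsFalsifyingConstant.finite_range_defect {hX : ∀ x ∈ X, x⁻¹ ∈ X} (hfin : X.Finite)
    (hgen : Subgroup.closure X = ⊤) {K : ℕ} (hK : IsFalsifyingConstant hX H K) :
    (Set.range (defect : RightCosets H → List X → ℕ)).Finite := by
  have := hfin.to_subtype
  have : Finite {b : List X // b.length ≤ 2 * K} := List.finite_length_le X (2 * K)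
  -- Lengths relative to the length of `c`, shifted by `2 * K` to be natural numbers.
  let F : RightCosets H → {b : List X // b.length ≤ 2 * K} → Fin (4 * K + 1) := fun c b =>
    ⟨cosetLength X (c <• evalWord b.1) + 2 * K - cosetLength X c, by
      have := cosetLength_smul_le hX hgen c b.1
      have := b.2
      omega⟩
  have hF : ∀ c d, F c = F d → (defect c : List X → ℕ) = defect d := by
    have key : ∀ c d, F c = F d → ∀ u : List X, (defect c u) ≤ defect d u := by
      intro c d hcd u
      have hle : defect c u ≤ 2 := min_le_left _ _
      obtain ⟨b, hb, v, hbv, hlen⟩ := (hK.le_defect_iff_exists hgen c u hle).1 le_rfl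
      refine (hK.le_defect_iff_exists hgen d u hle).2 ⟨b, hb, v, hbv, ?_⟩
      have hval := congrArg Fin.val (congrFun hcd ⟨b, hb⟩)
      have h₁ := cosetLength_le_smul hX hgen c b
      have h₂ := cosetLength_le_smul hX hgen d b
      simp only [F] at hval
      omega
    exact fun c d hcd => funext fun u => le_antisymm (key c d hcd u) (key d c hcd.symm u)
  refine (Set.finite_range fun f : Set.range F => (defect f.2.choose : List X → ℕ)).subset ?_
  rintro _ ⟨c, rfl⟩
  have hc : F c ∈ Set.range F := ⟨c, rfl⟩
  exact ⟨⟨F c, hc⟩, hF _ _ hc.choose_spec⟩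

/-- The left quotient of the language by one of its words `w` consists of the words of defect zero
at the coset of `w`, so that the Myhill–Nerode theorem applies. -/
theorem isRegular_geoLanguage (hX : ∀ x ∈ X, x⁻¹ ∈ X) (hgen : Subgroup.closure X = ⊤)
    (h : (Set.range (defect : RightCosets H → List X → ℕ)).Finite) :
    (geoLanguage H X).IsRegular := by
  refine Language.IsRegular.of_finite_range_leftQuotient
    (((h.image fun f => ({u | f u = 0} : Language X)).insert (∅ : Set (List X))).subset ?_)
  rintro _ ⟨w, rfl⟩
  by_cases hw : w ∈ geoLanguage H X
  · refine Or.inr ⟨_, ⟨rightCoset H (evalWord w), rfl⟩, ?_⟩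
    refine Set.ext fun u => ?_
    change defect (rightCoset H (evalWord w)) u = 0 ↔ w ++ u ∈ geoLanguage H X
    rw [mem_geoLanguage_iff hX hgen] at hw
    rw [mem_geoLanguage_iff hX hgen, defect_eq_zero_iff hX hgen, rightCoset_smul,
      ← evalWord_append, List.length_append, hw, eq_comm]
  · refine Or.inl (Set.eq_empty_of_forall_notMem fun u hu => hw ?_)
    -- The language is closed under taking prefixes.
    have hu' : w ++ u ∈ geoLanguage H X := hu
    rw [mem_geoLanguage_iff hX hgen] at hu' ⊢
    have h₁ := cosetLength_smul_le hX hgen (rightCoset H (evalWord w)) u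
    have h₂ := cosetLength_le (H := H) w
    rw [rightCoset_smul, ← evalWord_append, ← hu', List.length_append] at h₁
    omega

end Defect

/-! ### Rationality of series defined by a transfer matrix -/

section TransferMatrix

open Polynomial in
/-- Multiplication by the adjugate of `1 - X • A` solves the system of equations for the
generating functions of the coordinates of `N`, and the factor `1 - X` accounts for the passage
from the series with coefficients `∑ τ, N n τ` to the series of their partial sums. -/
theorem isRationalSeries_of_transferMatrix {T : Type*} [Fintype T] [DecidableEq T]
    (A : Matrix T T ℚ) (N : ℕ → T → ℚ) (hN : ∀ n, N (n + 1) = A.mulVec (N n)) (e : ℕ → ℚ)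
    (h₀ : e 0 = ∑ τ, N 0 τ) (hs : ∀ n, e (n + 1) = e n + ∑ τ, N (n + 1) τ) :
    (PowerSeries.mk e).IsRationalSeries := by
  let ι : ℚ[X] →+* PowerSeries ℚ := Polynomial.coeToPowerSeries.ringHom
  let F : T → PowerSeries ℚ := fun τ => PowerSeries.mk fun n => N n τ
  let B : Matrix T T ℚ[X] := 1 - (X : ℚ[X]) • A.map C
  let v : T → ℚ[X] := fun τ => C (N 0 τ)
  have hιX : ι X = PowerSeries.X := Polynomial.coe_X
  have hιC : ∀ a, ι (C a) = PowerSeries.C a := Polynomial.coe_C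
  have hBF : (B.map ι).mulVec F = fun τ => ι (v τ) := by
    have hB : B.map ι = 1 - (PowerSeries.X : PowerSeries ℚ) • (A.map fun a => PowerSeries.C a) := by
      ext1 i j
      simp only [B, Matrix.map_apply, Matrix.sub_apply, Matrix.smul_apply, smul_eq_mul, map_sub,
        map_mul, hιX, hιC, Matrix.one_apply]
      split_ifs <;> simp
    rw [hB, Matrix.sub_mulVec, Matrix.one_mulVec, Matrix.smul_mulVec]
    funext τ
    simp only [Pi.sub_apply, Pi.smul_apply, smul_eq_mul, v, hιC]
    ext n
    cases n with
    | zero => simp [F]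
    | succ n =>
      simp [F, PowerSeries.coeff_succ_X_mul, Matrix.mulVec, dotProduct, hN n]
  have hdet : ∀ τ, ι B.det * F τ = ι (B.adjugate.mulVec v τ) := by
    intro τ
    have h := congrArg (fun w => (B.adjugate.map ι).mulVec w τ) hBF
    simp only [Matrix.mulVec_mulVec, ← Matrix.map_mul, Matrix.adjugate_mul] at h
    rw [Matrix.map_smul' ι _ _ (map_mul ι), Matrix.map_one ι (map_zero ι) (map_one ι), Matrix.smul_mulVec,
      Matrix.one_mulVec] at h
    refine h.trans ?_
    simp [Matrix.mulVec, dotProduct, map_sum]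
  refine ⟨∑ τ, B.adjugate.mulVec v τ, B.det * (1 - X), ?_, ?_⟩
  · intro h
    have := congrArg (Polynomial.eval 0) h
    rw [Polynomial.eval_mul, show B.det = A.charpolyRev from rfl, Matrix.eval_charpolyRev] at this
    simp at this
  · have hE : (1 - PowerSeries.X) * PowerSeries.mk e = ∑ τ, F τ := by
      ext n
      cases n with
      | zero => simp [sub_mul, F, h₀]
      | succ n => simp [sub_mul, F, hs, PowerSeries.coeff_succ_X_mul]
    change ι (B.det * (1 - X)) * PowerSeries.mk e = ι (∑ τ, B.adjugate.mulVec v τ)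
    rw [map_mul, map_sub, map_one, hιX, mul_assoc, hE, Finset.mul_sum, map_sum]
    exact Finset.sum_congr rfl fun τ _ => hdet τ

end TransferMatrix

/-! ### Growth of the Schreier coset graph -/

section Growth

variable {G : Type u} [Group G] {X : Set G} {H : Subgroup G}

theorem mem_schreier_ball_iff (hX : ∀ x ∈ X, x⁻¹ ∈ X) (hgen : Subgroup.closure X = ⊤)
    (c : RightCosets H) (n : ℕ) :
    c ∈ (schreierGraph H X hX).ball (rightCoset H 1) n ↔ cosetLength X c ≤ n := by
  refine (actionGraph_dist_le_iff hX (rightCoset H 1) c n).trans ⟨?_, fun hc => ?_⟩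
  · rintro ⟨w, hw, rfl⟩
    rw [rightCoset_smul, one_mul]
    exact (cosetLength_le w).trans hw
  · obtain ⟨w, hw, rfl⟩ := exists_length_eq_cosetLength hX hgen c
    exact ⟨w, hw ▸ hc, by rw [rightCoset_smul, one_mul]⟩

theorem finite_cosetLength_le (hX : ∀ x ∈ X, x⁻¹ ∈ X) (hfin : X.Finite)
    (hgen : Subgroup.closure X = ⊤) (n : ℕ) :
    {c : RightCosets H | cosetLength X c ≤ n}.Finite := by
  have := hfin.to_subtype
  refine ((List.finite_length_le X n).image fun w => rightCoset H (evalWord w)).subset ?_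
  intro c hc
  obtain ⟨w, hw, rfl⟩ := exists_length_eq_cosetLength hX hgen c
  exact ⟨w, hw.trans_le hc, rfl⟩

open Classical in
/-- Counting the edges from the sphere of radius `n` to the vertices of type `τ` on the sphere of
radius `n + 1`, by terminal and by initial vertices, where the type of a vertex is its defect
function: a vertex of type `τ` has as many such incoming edges as there are letters of defect `2`,
and the outgoing edges are labelled by the letters of defect `0`. -/
theorem card_sphere_succ_mul (hX : ∀ x ∈ X, x⁻¹ ∈ X) [Fintype X]
    (hgen : Subgroup.closure X = ⊤) (S : ℕ → Finset (RightCosets H))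
    (hS : ∀ n c, c ∈ S n ↔ cosetLength X c = n) (n : ℕ) (τ : List X → ℕ) :
    ((S (n + 1)).filter fun d => defect d = τ).card *
        (Finset.univ.filter fun y : X => τ [y] = 2).card =
      ∑ c ∈ S n, (Finset.univ.filter fun x : X =>
        defect c [x] = 0 ∧ (fun u => defect c (x :: u)) = τ).card := by
  have hsm : ∀ (c : RightCosets H) (x : X), defect c [x] = 0 ↔
      cosetLength X (c <• (x : G)) = cosetLength X c + 1 := by
    intro c x
    rw [defect_eq_zero_iff hX hgen]
    simp
  have hdef : ∀ (c : RightCosets H) (x : X), defect c [x] = 0 →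
      (fun u => defect c (x :: u)) = defect (c <• (x : G)) := by
    intro c x h
    funext u
    have := defect_smul hX hgen h u
    simp only [evalWord_cons, evalWord_nil, mul_one] at this
    exact this.symm
  have hinv : ∀ (c : RightCosets H) (x : G), (c <• x) <• x⁻¹ = c := fun c x => by
    rw [← mul_smul, ← MulOpposite.op_mul, mul_inv_cancel, MulOpposite.op_one, one_smul]
  rw [← smul_eq_mul, ← Finset.sum_const]
  have hl : ∀ d ∈ (S (n + 1)).filter (fun d => defect d = τ),
      (Finset.univ.filter fun y : X => τ [y] = 2).card =
        (Finset.univ.filter fun y : X => defect d [y] = 2).card := by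
    intro d hd
    rw [(Finset.mem_filter.1 hd).2]
  rw [Finset.sum_congr rfl hl, ← Finset.card_sigma, ← Finset.card_sigma]
  -- Reversing an edge exchanges the two descriptions.
  refine Finset.card_nbij' (fun p => ⟨p.1 <• (p.2 : G), ⟨(p.2 : G)⁻¹, hX _ p.2.2⟩⟩)
    (fun p => ⟨p.1 <• (p.2 : G), ⟨(p.2 : G)⁻¹, hX _ p.2.2⟩⟩) ?_ ?_ ?_ ?_
  · rintro ⟨d, y⟩ h
    simp only [Finset.coe_sigma, Set.mem_sigma_iff, Finset.mem_coe, Finset.mem_filter, hS,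
      Finset.mem_univ, true_and, defect_singleton_eq_two_iff hX hgen] at h ⊢
    have h0 : defect (d <• (y : G)) [⟨(y : G)⁻¹, hX _ y.2⟩] = 0 := by
      rw [hsm, hinv]
      omega
    refine ⟨by omega, h0, ?_⟩
    rw [hdef _ _ h0, hinv, h.1.2]
  · rintro ⟨c, x⟩ h
    simp only [Finset.coe_sigma, Set.mem_sigma_iff, Finset.mem_coe, Finset.mem_filter, hS,
      Finset.mem_univ, true_and, defect_singleton_eq_two_iff hX hgen] at h ⊢
    have hx := (hsm c x).1 h.2.1
    refine ⟨⟨by omega, by rw [← hdef _ _ h.2.1, h.2.2]⟩, ?_⟩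
    rw [hinv]
    omega
  · rintro ⟨d, y⟩ -
    simp
  · rintro ⟨c, x⟩ -
    simp

/-- A vertex other than `H` has a neighbour closer to `H`. -/
theorem exists_defect_singleton_eq_two (hX : ∀ x ∈ X, x⁻¹ ∈ X) (hgen : Subgroup.closure X = ⊤)
    (c : RightCosets H) (hc : cosetLength X c ≠ 0) : ∃ y : X, defect c [y] = 2 := by
  obtain ⟨w, hw, rfl⟩ := exists_length_eq_cosetLength hX hgen c
  rcases List.eq_nil_or_concat w with rfl | ⟨v, x, rfl⟩
  · exact absurd hw.symm hc
  · refine ⟨⟨(x : G)⁻¹, hX _ x.2⟩, ?_⟩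
    rw [defect_singleton_eq_two_iff hX hgen]
    have he : rightCoset H (evalWord (v.concat x)) <• (x : G)⁻¹ = rightCoset H (evalWord v) := by
      rw [rightCoset_smul]
      simp
    have h₁ := cosetLength_le (H := H) v
    have h₂ := cosetLength_smul_le hX hgen (rightCoset H (evalWord v)) [x]
    rw [rightCoset_smul, ← evalWord_append, ← List.concat_eq_append] at h₂
    rw [he]
    simp only [List.length_concat, List.length_singleton] at hw h₂
    omega

open Classical in
theorem isRationalSeries_schreierGrowth (hX : ∀ x ∈ X, x⁻¹ ∈ X) (hfin : X.Finite)
    (hgen : Subgroup.closure X = ⊤)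
    (hdef : (Set.range (defect : RightCosets H → List X → ℕ)).Finite) :
    (PowerSeries.mk fun n => (schreierGrowth H X hX n : ℚ)).IsRationalSeries := by
  have := hfin.fintype
  have := hdef.fintype
  let type : RightCosets H → Set.range (defect : RightCosets H → List X → ℕ) :=
    fun c => ⟨defect c, c, rfl⟩
  have hballfin := finite_cosetLength_le (H := H) hX hfin hgen
  let S : ℕ → Finset (RightCosets H) := fun n =>
    ((hballfin n).subset fun c (hc : cosetLength X c = n) => hc.le).toFinset
  have hS : ∀ n c, c ∈ S n ↔ cosetLength X c = n := fun n c => Set.Finite.mem_toFinset _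
  let N : ℕ → Set.range (defect : RightCosets H → List X → ℕ) → ℚ :=
    fun n τ => ((S n).filter fun c => type c = τ).card
  let P : (List X → ℕ) → ℕ := fun τ => (Finset.univ.filter fun y : X => τ [y] = 2).card
  let a : (List X → ℕ) → (List X → ℕ) → ℕ := fun σ τ =>
    (Finset.univ.filter fun x : X => σ [x] = 0 ∧ (fun u => σ (x :: u)) = τ).card
  have hsum : ∀ n, ∑ τ, N n τ = (S n).card := by
    intro n
    simp only [N]
    rw [← Nat.cast_sum, ← Finset.card_eq_sum_card_fiberwise (fun c _ => Finset.mem_univ (type c))]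
  have hball : ∀ n, schreierGrowth H X hX n = (hballfin n).toFinset.card := by
    intro n
    exact (congrArg Set.ncard (Set.ext fun c => mem_schreier_ball_iff hX hgen c n)).trans
      (Set.ncard_eq_toFinset_card _ (hballfin n))
  refine isRationalSeries_of_transferMatrix
    (Matrix.of fun τ σ => (a σ.1 τ.1 : ℚ) / P τ.1) N (fun n => ?_) _ ?_ (fun n => ?_)
  · funext τ
    have hcount := card_sphere_succ_mul hX hgen S hS n τ.1
    have hfib : ∑ c ∈ S n, a (defect c) τ.1 =
        ∑ σ : Set.range (defect : RightCosets H → List X → ℕ),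
          ((S n).filter fun c => type c = σ).card * a σ.1 τ.1 := by
      rw [← Finset.sum_fiberwise (S n) type]
      refine Finset.sum_congr rfl fun σ _ => ?_
      rw [← smul_eq_mul, ← Finset.sum_const]
      refine Finset.sum_congr rfl fun c hc => ?_
      rw [← (Finset.mem_filter.1 hc).2]
    have hNτ : N (n + 1) τ = ((S (n + 1)).filter fun d => defect d = τ.1).card := by
      simp only [N, type, Subtype.ext_iff]
    have hmul : N (n + 1) τ * P τ.1 = ∑ σ, (a σ.1 τ.1 : ℚ) * N n σ := by
      rw [hNτ, ← Nat.cast_mul, hcount, hfib, Nat.cast_sum]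
      exact Finset.sum_congr rfl fun σ _ => by rw [Nat.cast_mul, mul_comm]
    simp only [Matrix.mulVec, dotProduct, Matrix.of_apply, div_mul_eq_mul_div]
    rw [← Finset.sum_div, ← hmul]
    by_cases hP : P τ.1 = 0
    · -- No vertex of positive length has this type, so that division by zero does no harm.
      rw [hP, Nat.cast_zero, div_zero, hNτ, Nat.cast_eq_zero, Finset.card_eq_zero,
        Finset.filter_eq_empty_iff]
      intro d hd hτ
      obtain ⟨y, hy⟩ := exists_defect_singleton_eq_two hX hgen d (by
        rw [(hS _ _).1 hd]; omega)
      rw [hτ] at hy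
      exact Finset.notMem_empty y
        (Finset.card_eq_zero.1 hP ▸ Finset.mem_filter.2 ⟨Finset.mem_univ y, hy⟩)
    · rw [mul_div_cancel_right₀ _ (Nat.cast_ne_zero.2 hP)]
  · rw [hsum, hball]
    congr 2
    ext c
    simp [hS]
  · rw [hsum, hball, hball, ← Nat.cast_add, ← Finset.card_union_of_disjoint]
    · congr 2
      ext c
      simp [hS]
      omega
    · rw [Finset.disjoint_left]
      intro c hc hc'
      rw [hS] at hc'
      simp at hc
      omega

end Growth

theorem theoremB {G : Type u} [Group G] (X : Set G) (hfin : X.Finite)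
    (hsymm : ∀ x ∈ X, x⁻¹ ∈ X) (hgen : Subgroup.closure X = ⊤)
    (hfftp : (cayleyGraph X hsymm).HasFFTP)
    (H : Subgroup G) (hH : (cayleyGraph X hsymm).HasFellowProjections (H : Set G)) :
    (schreierGraph H X hsymm).HasRelFFTP {p | p.start = rightCoset H 1} ∧
    (geoLanguage H X).IsRegular ∧
    ((cayleyGraph X hsymm).HasBoundedProjections (H : Set G) →
      (∀ n, ((schreierGraph H X hsymm).ball (rightCoset H 1) n).Finite) ∧
      (PowerSeries.mk fun n => (schreierGrowth H X hsymm n : ℚ)).IsRationalSeries) := by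
  obtain ⟨K, hK⟩ := exists_isFalsifyingConstant hsymm hfftp hH
  have hdef := hK.finite_range_defect hfin hgen
  refine ⟨hasRelFFTP_schreier hsymm hK, isRegular_geoLanguage hsymm hgen hdef, fun _ =>
    ⟨fun n => ?_, isRationalSeries_schreierGrowth hsymm hfin hgen hdef⟩⟩
  exact (finite_cosetLength_le hsymm hfin hgen n).subset fun c hc =>
    (mem_schreier_ball_iff hsymm hgen c n).1 hc
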